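/- Let $X$ be a real Banach space and let $\mathbb{R}\times X^*$ carry the norm $\|(a,x^*)\|=|a|+\|x^*\|$; the product of the standard topology of $\mathbb{R}$ and the weak$^*$ topology of $X^*$ is called the weak$^*$ topology of $\mathbb{R}\times X^*$, and $\operatorname{cl}^*$ denotes the closure in it, $\operatorname{cl}$ the norm closure and $\operatorname{co}$ the convex hull. A function $g\colon X\to\mathbb{R}\cup\{+\infty\}$ is closed convex if its epigraph is closed and convex, and $\operatorname{dom} g=\{x : g(x)\in\mathbb{R}\}$. A hypodifferential of $g$ at $x\in\operatorname{dom} g$ is a weak$^*$ compact set $H\subset\mathbb{R}\times X^*$ such that $\max_{(a,x^*)\in H}a=0$ and, for every $u\in X$, $$\lim_{\alpha\to+0}\frac1\alpha\Big|g(x+\alpha u)-g(x)-\max_{(a,x^*)\in H}\big(a+\alpha\langle x^*,u\rangle\big)\Big|=0;$$ $g$ is hypodifferentiable at $x$ if such a set exists. A map $\underline d g$ on a set $Q\subseteq\operatorname{dom} g$ is a hypodifferential mapping of $g$ on $Q$ if $\underline d g(x)$ is a hypodifferential of $g$ at $x$ for every $x\in Q$; it is consistent on $Q$ if moreover $g(y)-g(x)\ge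 a+\langle x^*,y-x\rangle$ for all $x\in Q$, $y\in X$, $(a,x^*)\in\underline d g(x)$. Set-valued maps are called continuous if they are continuous in the Pompeiu–Hausdorff distance (of the norm above). The function $g$ is continuously hypodifferentiable on $Q\subseteq\operatorname{int}\operatorname{dom} g$ if it has a continuous hypodifferential mapping on $Q$. **Theorem (maximum over a compact set).** Let $T$ be a nonempty compact topological space and let $f\colon X\times T\to\mathbb{R}\cup\{+\infty\}$ be such that 1. for every $x\in X$ the map $t\mapsto f(x,t)$ is continuous; 2. for every $t\in T$ the function $f_t=f(\cdot,t)$ is closed convex; 3. $Q$ is a nonempty subset of $\operatorname{int}\bigcap_{t\in T}\operatorname{dom} f_t$; 4. for every $t\in T$, $\underline d f_t$ is a consistent hypodifferential mapping of $f_t$ on $Q$; 5. the set-valued map $(x,t)\mapsto\underline d f_t(x)$ is continuous on $Q\times T$. Put $f(x)=\sup_{t\in T}f(x,t)$ and $D(x)=\operatorname{co}\{(f(x,t)-f(x),0)+(a,x^*) : t\in T,\ (a,x^*)\in\underline d f_t(x)\}$. Then $f$ is a closed convex function $X\to\mathbb{R}\cup\{+\infty\}$ that is hypodifferentiable at every point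 of $Q$, and $\underline d f(x)=\operatorname{cl}^*D(x)$, $x\in Q$, is a consistent hypodifferential mapping of $f$ on $Q$. If, in addition, either $X$ is reflexive or $\operatorname{cl}D(x)$ is weak$^*$ closed for all $x\in Q$, then $f$ is continuously hypodifferentiable on $Q$ and the mapping $\underline d f(\cdot)=\operatorname{cl}^*D(\cdot)$ is continuous on $Q$. -/

import Mathlib

open Set Filter Topology
open scoped ENNReal

noncomputable section

namespace Hypodiff

/-- Continuity on `S` of a set-valued map with respect to the Pompeiu-Hausdorff distance. -/
def PHContinuousOn {M E : Type*} [TopologicalSpace M] [PseudoEMetricSpace E]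
    (F : M → Set E) (S : Set M) : Prop :=
  ∀ x ∈ S, ∀ ε : ℝ≥0∞, 0 < ε → ∀ᶠ x' in 𝓝[S] x, Metric.hausdorffEDist (F x') (F x) < ε

section

variable {X : Type*} [NormedAddCommGroup X] [NormedSpace ℝ X]

/-- The effective domain of an extended-real-valued function. -/
def dom (f : X → EReal) : Set X := {x | f x ≠ ⊤ ∧ f x ≠ ⊥}

/-- A closed convex function `f : X → ℝ ∪ {+∞}`: it omits the value `-∞`, and its epigraph is
a closed convex subset of `X × ℝ`. -/
structure IsClosedConvex (f : X → EReal) : Prop where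
  ne_bot : ∀ x, f x ≠ ⊥
  convex_epi : Convex ℝ {p : X × ℝ | f p.1 ≤ (p.2 : EReal)}
  closed_epi : IsClosed {p : X × ℝ | f p.1 ≤ (p.2 : EReal)}

variable (X) in
/-- Reflexivity: the canonical embedding of `X` into its bidual is onto. -/
def IsReflexive : Prop :=
  Function.Surjective (NormedSpace.inclusionInDoubleDual ℝ X)

variable (X) in
/-- The space `ℝ × X*` with the norm `‖(a, x*)‖ = |a| + ‖x*‖`. -/
abbrev HypoSpace : Type _ := WithLp 1 (ℝ × StrongDual ℝ X)

/-- The identity map from `ℝ × X*` with the norm topology to `ℝ × X*` with the product of the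
standard topology of `ℝ` and the weak* topology of `X*`. -/
def toWeakStar (p : HypoSpace X) : ℝ × WeakDual ℝ X :=
  (p.fst, StrongDual.toWeakDual p.snd)

/-- Compactness in the weak* topology of `ℝ × X*`. -/
def IsWeakStarCompact (H : Set (HypoSpace X)) : Prop := IsCompact (toWeakStar '' H)

/-- Closedness in the weak* topology of `ℝ × X*`. -/
def IsWeakStarClosed (H : Set (HypoSpace X)) : Prop := IsClosed (toWeakStar '' H)

/-- Closure in the weak* topology of `ℝ × X*`. -/
def weakStarClosure (H : Set (HypoSpace X)) : Set (HypoSpace X) :=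
  toWeakStar ⁻¹' closure (toWeakStar '' H)

/-- `max {a + ⟨x*, u⟩ | (a, x*) ∈ H}`. For nonempty weak* compact `H`, the only case in which
it is used, the supremum is finite and attained. -/
def maxAffine (H : Set (HypoSpace X)) (u : X) : ℝ :=
  sSup ((fun p : HypoSpace X => p.fst + p.snd u) '' H)

/-- `H` is a hypodifferential of `f` at `x`. The absolute value is `[0, ∞]`-valued, since `f` may
take the value `+∞` near `x`. -/
structure IsHypodifferentialAt (f : X → EReal) (x : X) (H : Set (HypoSpace X)) : Prop where
  mem_dom : x ∈ dom f
  compact : IsWeakStarCompact H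
  max_zero : IsGreatest ((fun p : HypoSpace X => p.fst) '' H) 0
  approx : ∀ u : X, Tendsto
    (fun α : ℝ => ENNReal.ofReal (1 / α) *
      (f (x + α • u) - f x - (maxAffine H (α • u) : EReal)).abs)
    (𝓝[>] 0) (𝓝 0)

/-- `f` is hypodifferentiable at `x`. -/
def HypodifferentiableAt (f : X → EReal) (x : X) : Prop :=
  ∃ H : Set (HypoSpace X), IsHypodifferentialAt f x H

/-- `H` is a hypodifferential mapping of `f` on `Q`; only its values on `Q` matter. -/
def IsHypodifferentialOn (f : X → EReal) (Q : Set X) (H : X → Set (HypoSpace X)) : Prop :=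
  ∀ x ∈ Q, IsHypodifferentialAt f x (H x)

/-- `H` is a consistent hypodifferential mapping of `f` on `Q`. -/
def IsConsistentHypodifferentialOn (f : X → EReal) (Q : Set X)
    (H : X → Set (HypoSpace X)) : Prop :=
  IsHypodifferentialOn f Q H ∧
    ∀ x ∈ Q, ∀ y : X, ∀ p ∈ H x, ((p.fst + p.snd (y - x) : ℝ) : EReal) ≤ f y - f x

/-- `f` is continuously hypodifferentiable on `Q`. -/
def ContinuouslyHypodifferentiableOn (f : X → EReal) (Q : Set X) : Prop :=
  Q ⊆ interior (dom f) ∧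
    ∃ H : X → Set (HypoSpace X), IsHypodifferentialOn f Q H ∧ PHContinuousOn H Q

/-- The function `x ↦ sup_{t ∈ T} f(x, t)`. -/
def supFun {T : Type*} (f : X → T → EReal) (x : X) : EReal := ⨆ t, f x t

/-- The set `D(x) = co {(f(x, t) - f(x), 0) + d f_t(x) | t ∈ T}`, where `f(x) = sup_t f(x, t)`;
it is used only at points `x` at which all these values of `f` are finite. -/
def preHypodiff {T : Type*} (f : X → T → EReal) (d : T → X → Set (HypoSpace X)) (x : X) :
    Set (HypoSpace X) :=
  convexHull ℝ {q | ∃ t : T, ∃ p ∈ d t x,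
    q = WithLp.toLp 1 ((f x t).toReal - (supFun f x).toReal, (0 : StrongDual ℝ X)) + p}

end

end Hypodiff

end

/-! Each generator `(f(x,t) - f(x), 0) + (a, x*)` is an affine minorant of `f` based at `x`, because
consistency of `f_t` gives `f(x,t) + a + ⟨x*, y - x⟩ ≤ f(y,t) ≤ f(y)`. Affine upper bounds survive
convex hulls and weak* closures, so `cl* D(x)` is consistent. This is already the lower half of the
first-order expansion, with no error term. Setting `y = x` gives `a ≤ 0` on `cl* D(x)`; an index
attaining the maximum makes `0` the greatest value. Norm boundedness of the generators and
Banach-Alaoglu give weak* compactness.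

The upper half (`eventually_supFun_ray_lt`) is by contradiction. Let `M` be the right slope at zero
of `α ↦ max (a + α ⟨x*, u⟩)`. If `f` does not eventually drop below the line of slope `M + ε`,
convexity and compactness of `T` yield one index `t` whose `f_t` stays above that line along the
whole ray (`exists_forall_ray_le`). Letting `α → 0` shows that `t` is active at `x`, so its
hypodifferential lies in `cl* D(x)` and has slope at most `M`, which contradicts the expansion of
`f_t`.

For continuity, compactness of `T` makes the hypodifferentials and the values `f(x,t)` vary
uniformly in `t`, so the generators vary continuously;
`exists_dist_le_of_mem_weakStarClosure_convexHull` carries the estimate to weak* closed hulls. -/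

namespace Hypodiff

/-! ### Weak* compactness and closed convex hulls in `ℝ × X*` -/

section WeakStar

variable {X : Type*} [NormedAddCommGroup X] [NormedSpace ℝ X]

theorem toWeakStar_injective : Function.Injective (toWeakStar (X := X)) := by
  intro p q h
  have h1 : p.fst = q.fst := congrArg Prod.fst h
  have h2 : p.snd = q.snd := StrongDual.toWeakDual.injective (congrArg Prod.snd h)
  exact (WithLp.ofLp_injective 1) (Prod.ext h1 h2)

theorem toWeakStar_surjective : Function.Surjective (toWeakStar (X := X)) := fun z =>
  ⟨WithLp.toLp 1 (z.1, WeakDual.toStrongDual z.2), rfl⟩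

theorem toWeakStar_add (p q : HypoSpace X) :
    toWeakStar (p + q) = toWeakStar p + toWeakStar q := rfl

theorem image_weakStarClosure (H : Set (HypoSpace X)) :
    toWeakStar '' weakStarClosure H = closure (toWeakStar '' H) :=
  image_preimage_eq _ toWeakStar_surjective

theorem subset_weakStarClosure (H : Set (HypoSpace X)) : H ⊆ weakStarClosure H := fun _ hp =>
  subset_closure (mem_image_of_mem _ hp)

theorem continuous_affine_eval (u : X) :
    Continuous fun z : ℝ × WeakDual ℝ X => z.1 + z.2 u :=
  continuous_fst.add ((WeakDual.eval_continuous u).comp continuous_snd)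

theorem norm_fst_le (p : HypoSpace X) : ‖p.fst‖ ≤ ‖p‖ := by
  rw [WithLp.prod_norm_eq_of_L1]
  exact le_add_of_nonneg_right (norm_nonneg _)

theorem norm_snd_le (p : HypoSpace X) : ‖p.snd‖ ≤ ‖p‖ := by
  rw [WithLp.prod_norm_eq_of_L1]
  exact le_add_of_nonneg_left (norm_nonneg _)

theorem snd_apply_le (p : HypoSpace X) (u : X) : p.snd u ≤ ‖p‖ * ‖u‖ :=
  (le_abs_self _).trans <| (p.snd.le_opNorm u).trans <|
    mul_le_mul_of_nonneg_right (norm_snd_le p) (norm_nonneg u)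

/-- Weak* compact subsets of `ℝ × X*` are norm bounded. -/
theorem IsWeakStarCompact.exists_norm_le [CompleteSpace X] {H : Set (HypoSpace X)}
    (hH : IsWeakStarCompact H) : ∃ R : ℝ, ∀ p ∈ H, ‖p‖ ≤ R := by
  obtain ⟨A, hA⟩ := (hH.image continuous_fst).isBounded.exists_norm_le
  have hpt : ∀ u : X, ∃ C, ∀ i : H, ‖(i : HypoSpace X).snd u‖ ≤ C := fun u => by
    obtain ⟨C, hC⟩ := (hH.image
      ((WeakDual.eval_continuous u).comp continuous_snd)).isBounded.exists_norm_le
    exact ⟨C, fun i => hC _ ⟨_, mem_image_of_mem _ i.2, rfl⟩⟩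
  -- Evaluations at each `u` are bounded on a weak* compact set; completeness of `X` makes the bound
  -- uniform.
  obtain ⟨B, hB⟩ := banach_steinhaus hpt
  refine ⟨A + B, fun p hp => ?_⟩
  rw [WithLp.prod_norm_eq_of_L1]
  exact add_le_add (hA _ ⟨_, mem_image_of_mem _ hp, rfl⟩) (hB ⟨p, hp⟩)

/-- The set `{(a, x*) : |a| ≤ R, ‖x*‖ ≤ R}` in the weak* topology. -/
theorem isCompact_weakStar_box (R : ℝ) :
    IsCompact (Metric.closedBall (0 : ℝ) R ×ˢ
      (WeakDual.toStrongDual ⁻¹' Metric.closedBall (0 : StrongDual ℝ X) R)) :=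
  (isCompact_closedBall 0 R).prod (WeakDual.isCompact_closedBall 0 R)

theorem toWeakStar_mem_box {p : HypoSpace X} {R : ℝ} (hp : ‖p‖ ≤ R) :
    toWeakStar p ∈ Metric.closedBall (0 : ℝ) R ×ˢ
      (WeakDual.toStrongDual ⁻¹' Metric.closedBall (0 : StrongDual ℝ X) R) := by
  refine ⟨?_, ?_⟩
  · simpa [toWeakStar] using (norm_fst_le p).trans hp
  · simpa [toWeakStar] using (norm_snd_le p).trans hp

theorem norm_le_of_toWeakStar_mem_box {p : HypoSpace X} {R : ℝ}
    (hp : toWeakStar p ∈ Metric.closedBall (0 : ℝ) R ×ˢ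
      (WeakDual.toStrongDual ⁻¹' Metric.closedBall (0 : StrongDual ℝ X) R)) : ‖p‖ ≤ 2 * R := by
  obtain ⟨h1, h2⟩ := hp
  have h1' : ‖p.fst‖ ≤ R := by simpa [toWeakStar] using h1
  have h2' : ‖p.snd‖ ≤ R := by simpa [toWeakStar] using h2
  rw [WithLp.prod_norm_eq_of_L1]
  linarith

/-- The weak* closure of a norm bounded set is weak* compact. -/
theorem isWeakStarCompact_weakStarClosure {H : Set (HypoSpace X)} {R : ℝ}
    (hH : ∀ p ∈ H, ‖p‖ ≤ R) : IsWeakStarCompact (weakStarClosure H) := by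
  unfold IsWeakStarCompact
  rw [image_weakStarClosure]
  refine (isCompact_weakStar_box R).closure_of_subset ?_
  rintro _ ⟨p, hp, rfl⟩
  exact toWeakStar_mem_box (hH p hp)

theorem convexHull_norm_le {S : Set (HypoSpace X)} {R : ℝ} (hS : ∀ p ∈ S, ‖p‖ ≤ R) :
    ∀ p ∈ convexHull ℝ S, ‖p‖ ≤ R := fun p hp => by
  have : convexHull ℝ S ⊆ Metric.closedBall 0 R :=
    convexHull_min (fun q hq => by simpa using hS q hq) (convex_closedBall _ _)
  simpa using this hp

/-- An upper bound of an affine functional passes to the weak* closed convex hull. -/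
theorem affine_le_of_mem_weakStarClosure_convexHull {S : Set (HypoSpace X)} {v : X} {C : ℝ}
    (hS : ∀ p ∈ S, p.fst + p.snd v ≤ C) :
    ∀ p ∈ weakStarClosure (convexHull ℝ S), p.fst + p.snd v ≤ C := by
  have hconv : Convex ℝ {p : HypoSpace X | p.fst + p.snd v ≤ C} := by
    intro p hp q hq a b ha hb hab
    have hp' : p.fst + p.snd v ≤ C := hp
    have hq' : q.fst + q.snd v ≤ C := hq
    change a * p.fst + b * q.fst + (a * p.snd v + b * q.snd v) ≤ C
    calc a * p.fst + b * q.fst + (a * p.snd v + b * q.snd v)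
        = a * (p.fst + p.snd v) + b * (q.fst + q.snd v) := by ring
      _ ≤ a * C + b * C := by gcongr
      _ = C := by rw [← add_mul, hab, one_mul]
  have hcl : IsClosed {z : ℝ × WeakDual ℝ X | z.1 + z.2 v ≤ C} :=
    isClosed_le (continuous_affine_eval v) continuous_const
  intro p hp
  have hsub : toWeakStar '' convexHull ℝ S ⊆ {z : ℝ × WeakDual ℝ X | z.1 + z.2 v ≤ C} := by
    rintro _ ⟨q, hq, rfl⟩
    exact convexHull_min hS hconv hq
  exact closure_minimal hsub hcl hp

/-- Weak* closed convex hulls inherit a uniform estimate of the excess of one set over another. -/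
theorem exists_dist_le_of_mem_weakStarClosure_convexHull {S S' : Set (HypoSpace X)} {R δ : ℝ}
    (hR : ∀ p ∈ S, ‖p‖ ≤ R) (h : ∀ p ∈ S', ∃ q ∈ S, dist p q < δ) :
    ∀ p ∈ weakStarClosure (convexHull ℝ S'),
      ∃ q ∈ weakStarClosure (convexHull ℝ S), dist p q ≤ 2 * δ := by
  have hthick : convexHull ℝ S' ⊆ Metric.thickening δ (convexHull ℝ S) := by
    refine convexHull_min (fun p hp => ?_) ((convex_convexHull ℝ S).thickening δ)
    obtain ⟨q, hq, hpq⟩ := h p hp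
    exact Metric.mem_thickening_iff.2 ⟨q, subset_convexHull ℝ S hq, hpq⟩
  set B := Metric.closedBall (0 : ℝ) δ ×ˢ
      (WeakDual.toStrongDual ⁻¹' Metric.closedBall (0 : StrongDual ℝ X) δ)
  have hC : IsCompact (closure (toWeakStar '' convexHull ℝ S)) := by
    rw [← image_weakStarClosure]
    exact isWeakStarCompact_weakStarClosure (convexHull_norm_le hR)
  -- The sum of a weak* compact set and a weak* compact box is compact, hence closed, so it absorbs
  -- the weak* closure of the hull of `S'`.
  have hsum := (hC.prod (isCompact_weakStar_box (X := X) δ)).image continuous_add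
  have hsub : toWeakStar '' convexHull ℝ S' ⊆
      (fun z : (ℝ × WeakDual ℝ X) × (ℝ × WeakDual ℝ X) => z.1 + z.2) ''
        (closure (toWeakStar '' convexHull ℝ S) ×ˢ B) := by
    rintro _ ⟨p, hp, rfl⟩
    obtain ⟨q, hq, hpq⟩ := Metric.mem_thickening_iff.1 (hthick hp)
    refine ⟨(toWeakStar q, toWeakStar (p - q)),
      ⟨subset_closure (mem_image_of_mem _ hq), toWeakStar_mem_box ?_⟩, ?_⟩
    · rw [← dist_eq_norm]; exact hpq.le
    · simp only [← toWeakStar_add]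
      rw [add_sub_cancel]
  intro p hp
  obtain ⟨⟨z, w⟩, ⟨hz, hw⟩, hzw⟩ := closure_minimal hsub hsum.isClosed hp
  obtain ⟨q, rfl⟩ := toWeakStar_surjective z
  obtain ⟨e, rfl⟩ := toWeakStar_surjective w
  have hpe : q + e = p := toWeakStar_injective (by rw [toWeakStar_add]; exact hzw)
  refine ⟨q, hz, ?_⟩
  rw [← hpe, dist_eq_norm, add_sub_cancel_left]
  -- The box bounds the two coordinates separately by `δ`, whence the factor `2` in the sum norm.
  exact norm_le_of_toWeakStar_mem_box hw

end WeakStar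

/-! ### The support-type function of a hypodifferential -/

section MaxAffine

variable {X : Type*} [NormedAddCommGroup X] [NormedSpace ℝ X]

theorem bddAbove_affine {H : Set (HypoSpace X)} (hH : IsWeakStarCompact H) (u : X) :
    BddAbove ((fun p : HypoSpace X => p.fst + p.snd u) '' H) := by
  have h := (hH.image (continuous_affine_eval u)).bddAbove
  rwa [image_image] at h

theorem le_maxAffine {H : Set (HypoSpace X)} (hH : IsWeakStarCompact H) {p : HypoSpace X}
    (hp : p ∈ H) (u : X) : p.fst + p.snd u ≤ maxAffine H u :=
  le_csSup (bddAbove_affine hH u) ⟨p, hp, rfl⟩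

theorem maxAffine_le {H : Set (HypoSpace X)} (hne : H.Nonempty) {u : X} {C : ℝ}
    (h : ∀ p ∈ H, p.fst + p.snd u ≤ C) : maxAffine H u ≤ C :=
  csSup_le (hne.image _) (by rintro _ ⟨p, hp, rfl⟩; exact h p hp)

theorem maxAffine_mono {H K : Set (HypoSpace X)} (hne : H.Nonempty) (hK : IsWeakStarCompact K)
    (h : H ⊆ K) (u : X) : maxAffine H u ≤ maxAffine K u :=
  maxAffine_le hne fun _ hp => le_maxAffine hK (h hp) u

/-- The support-type function `α ↦ max (a + α ⟨x*, u⟩)` has a right slope `M` at zero and lies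
above the line of slope `M`. -/
theorem exists_slope_maxAffine {H : Set (HypoSpace X)} (hH : IsWeakStarCompact H)
    (h0 : IsGreatest ((fun p : HypoSpace X => p.fst) '' H) 0) (u : X) :
    ∃ M : ℝ, (∀ α : ℝ, 0 < α → α * M ≤ maxAffine H (α • u)) ∧
      ∀ ε : ℝ, 0 < ε → ∀ᶠ α in 𝓝[>] (0 : ℝ), maxAffine H (α • u) < α * (M + ε) := by
  obtain ⟨⟨p₀, hp₀, hp₀0⟩, hle⟩ := h0
  have hne : H.Nonempty := ⟨p₀, hp₀⟩
  -- An element with `a = 0` bounds all difference quotients from below; their infimum will be `M`.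
  have hbdd : BddBelow ((fun α : ℝ => maxAffine H (α • u) / α) '' Ioi 0) := by
    refine ⟨p₀.snd u, ?_⟩
    rintro _ ⟨α, hα, rfl⟩
    have h := le_maxAffine hH hp₀ (α • u)
    simp only at hp₀0
    rw [hp₀0, map_smul, smul_eq_mul, zero_add] at h
    rw [le_div_iff₀ hα, mul_comm]
    exact h
  refine ⟨sInf ((fun α : ℝ => maxAffine H (α • u) / α) '' Ioi 0), fun α hα => ?_, fun ε hε => ?_⟩
  · have h := csInf_le hbdd ⟨α, hα, rfl⟩
    rw [le_div_iff₀ hα] at h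
    linarith
  · obtain ⟨_, ⟨β, hβ, rfl⟩, hlt⟩ := exists_lt_of_csInf_lt (nonempty_Ioi.image _)
      (lt_add_of_pos_right (sInf ((fun α : ℝ => maxAffine H (α • u) / α) '' Ioi 0)) hε)
    filter_upwards [Ioc_mem_nhdsGT hβ] with α hα
    refine lt_of_le_of_lt ?_ (mul_lt_mul_of_pos_left hlt hα.1)
    refine maxAffine_le hne fun p hp => ?_
    have hp0 : p.fst ≤ 0 := hle ⟨p, hp, rfl⟩
    have h := le_maxAffine hH hp (β • u)
    rw [map_smul, smul_eq_mul] at h ⊢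
    have hβ' : (0 : ℝ) < β := hβ
    -- As `a ≤ 0`, the quotient `a / α` increases with `α`; a quotient close to the infimum at `β`
    -- therefore controls all smaller `α`.
    have h1 : p.fst / α ≤ p.fst / β := by
      rw [div_le_div_iff₀ hα.1 hβ']
      exact mul_le_mul_of_nonpos_left hα.2 hp0
    calc p.fst + α * p.snd u = α * (p.fst / α + p.snd u) := by
          have := hα.1.ne'
          field_simp
      _ ≤ α * (p.fst / β + p.snd u) := by
          have := hα.1.le
          gcongr
      _ = α * ((p.fst + β * p.snd u) / β) := by
          field_simp
      _ ≤ α * (maxAffine H (β • u) / β) := by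
          have := hα.1.le
          gcongr

end MaxAffine

end Hypodiff

namespace Hypodiff

/-! ### The first-order expansion as one-sided inequalities -/

section Approx

/-- Multiplication by the finite positive factor `α` trades the `[0, ∞]`-valued limit for an `o(α)`
estimate. -/
theorem tendsto_scaled_abs_iff (φ : ℝ → EReal) :
    Tendsto (fun α : ℝ => ENNReal.ofReal (1 / α) * (φ α).abs) (𝓝[>] 0) (𝓝 0) ↔
      ∀ ε : ℝ, 0 < ε → ∀ᶠ α in 𝓝[>] (0 : ℝ), (φ α).abs ≤ ENNReal.ofReal (α * ε) := by
  have key : ∀ α ε : ℝ, 0 < α → ∀ z : ℝ≥0∞,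
      ENNReal.ofReal (1 / α) * z ≤ ENNReal.ofReal ε ↔ z ≤ ENNReal.ofReal (α * ε) := by
    intro α ε hα z
    have hα0 : ENNReal.ofReal α ≠ 0 := by simpa using hα
    rw [ENNReal.ofReal_mul hα.le, one_div, ENNReal.ofReal_inv_of_pos hα, mul_comm,
      ← div_eq_mul_inv, ENNReal.div_le_iff' hα0 ENNReal.ofReal_ne_top]
  rw [ENNReal.tendsto_nhds_zero]
  constructor
  · intro h ε hε
    filter_upwards [h (ENNReal.ofReal ε) (by simpa using hε), self_mem_nhdsWithin] with α h1 hα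
    exact (key α ε hα _).1 h1
  · intro h ε hε
    obtain ⟨r, hr, hrε⟩ := ENNReal.lt_iff_exists_nnreal_btwn.1 hε
    have hr0 : (0 : ℝ) < r := by exact_mod_cast hr
    filter_upwards [h r hr0, self_mem_nhdsWithin] with α h1 hα
    refine ((key α r hα _).2 h1).trans ?_
    rw [ENNReal.ofReal_coe_nnreal]
    exact hrε.le

theorem le_of_abs_sub_sub_le {y : EReal} {c m δ : ℝ} (hδ : 0 ≤ δ)
    (h : (y - (c : EReal) - (m : EReal)).abs ≤ ENNReal.ofReal δ) :
    y ≤ ((c + m + δ : ℝ) : EReal) := by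
  induction y with
  | bot => exact bot_le
  | top => simp at h
  | coe y =>
    rw [← EReal.coe_sub, ← EReal.coe_sub, EReal.abs_def, ENNReal.ofReal_le_ofReal_iff hδ] at h
    have := (abs_le.1 h).2
    exact EReal.coe_le_coe_iff.2 (by linarith)

theorem abs_sub_sub_le {y : EReal} {c m δ : ℝ}
    (h1 : ((c + m : ℝ) : EReal) ≤ y) (h2 : y ≤ ((c + m + δ : ℝ) : EReal)) :
    (y - (c : EReal) - (m : EReal)).abs ≤ ENNReal.ofReal δ := by
  induction y with
  | bot => exact absurd (le_bot_iff.1 h1) (EReal.coe_ne_bot _)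
  | top => exact absurd (top_le_iff.1 h2) (EReal.coe_ne_top _)
  | coe y =>
    rw [EReal.coe_le_coe_iff] at h1 h2
    rw [← EReal.coe_sub, ← EReal.coe_sub, EReal.abs_def]
    exact ENNReal.ofReal_le_ofReal (abs_le.2 ⟨by linarith, by linarith⟩)

end Approx

theorem le_supFun {X T : Type*} (f : X → T → EReal) (x : X) (t : T) : f x t ≤ supFun f x :=
  le_iSup (f x) t

theorem coe_toReal_of_mem_dom {X : Type*} {g : X → EReal} {x : X} (h : x ∈ dom g) :
    ((g x).toReal : EReal) = g x := EReal.coe_toReal h.1 h.2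

/-! ### Attainment of the supremum -/

section Attained

variable {X T : Type*} {f : X → T → EReal} [TopologicalSpace T] [CompactSpace T] [Nonempty T]

theorem exists_eq_supFun (hcont : ∀ x, Continuous fun t => f x t) (x : X) :
    ∃ t, f x t = supFun f x := by
  obtain ⟨t, -, ht⟩ := isCompact_univ.exists_isMaxOn univ_nonempty (hcont x).continuousOn
  exact ⟨t, le_antisymm (le_supFun f x t) (iSup_le fun s => ht (mem_univ s))⟩

theorem iInter_dom_subset_dom_supFun (hcont : ∀ x, Continuous fun t => f x t) :
    (⋂ t, dom fun x => f x t) ⊆ dom (supFun f) := by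
  intro x hx
  obtain ⟨t, ht⟩ := exists_eq_supFun hcont x
  have h := mem_iInter.1 hx t
  change supFun f x ≠ ⊤ ∧ supFun f x ≠ ⊥
  rw [← ht]
  exact h

end Attained

/-! ### Convexity along rays -/

section Sup

variable {X : Type*} [NormedAddCommGroup X] [NormedSpace ℝ X] {T : Type*} {f : X → T → EReal}

theorem IsClosedConvex.supFun [Nonempty T] (hconv : ∀ t, IsClosedConvex fun x => f x t) :
    IsClosedConvex (supFun f) := by
  have hepi : {p : X × ℝ | Hypodiff.supFun f p.1 ≤ (p.2 : EReal)} =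
      ⋂ t, {p : X × ℝ | f p.1 t ≤ (p.2 : EReal)} := by
    ext p
    simp [Hypodiff.supFun]
  refine ⟨fun x hx => ?_, ?_, ?_⟩
  · obtain ⟨t⟩ := ‹Nonempty T›
    exact (hconv t).ne_bot x (le_bot_iff.1 (hx ▸ le_supFun f x t))
  · rw [hepi]
    exact convex_iInter fun t => (hconv t).convex_epi
  · rw [hepi]
    exact isClosed_iInter fun t => (hconv t).closed_epi

/-- The chord from `(x, c)` to an epigraph point strictly below the line `c + α s` stays strictly
below that line, except at its starting point. -/
theorem IsClosedConvex.lt_of_ray_lt {g : X → EReal} (hg : IsClosedConvex g) {x u : X}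
    {c s α β : ℝ} (hc : g x ≤ c) (hβ : 0 < β) (hβα : β ≤ α)
    (h : g (x + α • u) < ((c + α * s : ℝ) : EReal)) :
    g (x + β • u) < ((c + β * s : ℝ) : EReal) := by
  have hα : 0 < α := hβ.trans_le hβα
  obtain ⟨r, hr1, hr2⟩ := EReal.lt_iff_exists_real_btwn.1 h
  have hr : r < c + α * s := EReal.coe_lt_coe_iff.1 hr2
  have hmem := hg.convex_epi (x := (x, c)) hc (y := (x + α • u, r)) hr1.le
    (a := 1 - β / α) (b := β / α) (sub_nonneg.2 ((div_le_one hα).2 hβα)) (by positivity)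
    (by ring)
  have h1 : (1 - β / α) • x + (β / α) • (x + α • u) = x + β • u := by
    rw [smul_add, smul_smul, div_mul_cancel₀ _ hα.ne', sub_smul, one_smul]
    abel
  have h2 : g (x + β • u) ≤ (((1 - β / α) * c + β / α * r : ℝ) : EReal) := by
    have h3 : g ((1 - β / α) • x + (β / α) • (x + α • u)) ≤
      (((1 - β / α) * c + β / α * r : ℝ) : EReal) := hmem
    rwa [h1] at h3
  refine h2.trans_lt (EReal.coe_lt_coe_iff.2 ?_)
  have hpos : 0 < β / α := by positivity
  calc (1 - β / α) * c + β / α * r < (1 - β / α) * c + β / α * (c + α * s) := by gcongr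
    _ = c + β * s := by field_simp; ring

variable [TopologicalSpace T] [CompactSpace T] [Nonempty T]

/-- If the maximum function does not eventually fall below the line `c + α s` along a ray, then
a single index is responsible for it. -/
theorem exists_forall_ray_le (hcont : ∀ x, Continuous fun t => f x t)
    (hconv : ∀ t, IsClosedConvex fun x => f x t) {x u : X} {c s : ℝ} (hc : supFun f x = c)
    (h : ¬ ∀ᶠ α in 𝓝[>] (0 : ℝ), supFun f (x + α • u) < ((c + α * s : ℝ) : EReal)) :
    ∃ t, ∀ α : ℝ, 0 < α → ((c + α * s : ℝ) : EReal) ≤ f (x + α • u) t := by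
  -- The closed sets of indices above the line shrink as `α` decreases; a common point exists by
  -- compactness once each is nonempty.
  let K : Ioi (0 : ℝ) → Set T := fun α => {t | ((c + α * s : ℝ) : EReal) ≤ f (x + (α : ℝ) • u) t}
  have hmono : ∀ α β : Ioi (0 : ℝ), (β : ℝ) ≤ α → K β ⊆ K α := by
    intro α β hβα t ht
    by_contra hlt
    refine absurd ((hconv t).lt_of_ray_lt (hc ▸ le_supFun f x t) β.2 hβα (not_le.1 hlt)) ?_
    exact not_lt.2 ht
  have hne : ∀ α, (K α).Nonempty := by
    intro α
    -- The line is reached for arbitrarily small parameters; a maximizing index at some `β ≤ α` lies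
    -- in `K β ⊆ K α`.
    obtain ⟨β, hβ, hβα⟩ := ((not_eventually.1 h).and_eventually (Ioc_mem_nhdsGT α.2)).exists
    obtain ⟨t, ht⟩ := exists_eq_supFun hcont (x + β • u)
    refine ⟨t, hmono α ⟨β, hβα.1⟩ hβα.2 ?_⟩
    change _ ≤ f (x + β • u) t
    rw [ht]
    exact not_lt.1 hβ
  have hcl : ∀ α, IsClosed (K α) := fun α => isClosed_le continuous_const (hcont _)
  have : Nonempty (Ioi (0 : ℝ)) := ⟨⟨1, mem_Ioi.2 one_pos⟩⟩
  obtain ⟨t, ht⟩ := IsCompact.nonempty_iInter_of_directed_nonempty_isCompact_isClosed K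
    (fun α β => ⟨⟨min (α : ℝ) β, mem_Ioi.2 (lt_min α.2 β.2)⟩, hmono _ _ (min_le_left _ _),
      hmono _ _ (min_le_right _ _)⟩) hne (fun α => (hcl α).isCompact) hcl
  exact ⟨t, fun α hα => mem_iInter.1 ht ⟨α, hα⟩⟩

end Sup

/-! ### Affine minorants and Lipschitz estimates -/

section Consistency

variable {X : Type*} [NormedAddCommGroup X] [NormedSpace ℝ X]

theorem IsConsistentHypodifferentialOn.add_le {g : X → EReal} {Q : Set X}
    {H : X → Set (HypoSpace X)} (h : IsConsistentHypodifferentialOn g Q H) {x : X} (hx : x ∈ Q)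
    {p : HypoSpace X} (hp : p ∈ H x) (y : X) :
    (((g x).toReal + (p.fst + p.snd (y - x)) : ℝ) : EReal) ≤ g y := by
  have h1 := h.2 x hx y p hp
  rw [← coe_toReal_of_mem_dom (h.1 x hx).mem_dom] at h1
  have h2 := EReal.add_le_of_le_sub h1
  rwa [← EReal.coe_add, add_comm] at h2

/-- An element with `a = 0` is a subgradient at `x`, so its norm bounds the decrease from `x` to
`y`. -/
theorem IsConsistentHypodifferentialOn.toReal_sub_le {g : X → EReal} {Q : Set X}
    {H : X → Set (HypoSpace X)} (h : IsConsistentHypodifferentialOn g Q H) {x y : X}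
    (hx : x ∈ Q) (hy : y ∈ Q) {R : ℝ} (hR : ∀ p ∈ H x, ‖p‖ ≤ R) :
    (g x).toReal - (g y).toReal ≤ R * ‖x - y‖ := by
  obtain ⟨p, hp, hp0⟩ := (h.1 x hx).max_zero.1
  have h1 := h.add_le hx hp y
  rw [← coe_toReal_of_mem_dom (h.1 y hy).mem_dom, EReal.coe_le_coe_iff] at h1
  simp only at hp0
  have h2 := snd_apply_le p (x - y)
  have h3 : p.snd (x - y) = - p.snd (y - x) := by rw [← map_neg, neg_sub]
  have h4 : ‖p‖ * ‖x - y‖ ≤ R * ‖x - y‖ :=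
    mul_le_mul_of_nonneg_right (hR p hp) (norm_nonneg _)
  linarith

end Consistency

end Hypodiff

namespace Hypodiff

/-! ### Uniformity over the compact index space -/

section Uniform

variable {M T E : Type*} [TopologicalSpace M] [TopologicalSpace T]

theorem PHContinuousOn.eventually_right_lt [PseudoEMetricSpace E] {F : M × T → Set E} {Q : Set M}
    (hF : PHContinuousOn F (Q ×ˢ univ)) {x : M} (hx : x ∈ Q) (t : T) {ε : ℝ≥0∞} (hε : 0 < ε) :
    ∀ᶠ t' in 𝓝 t, Metric.hausdorffEDist (F (x, t')) (F (x, t)) < ε := by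
  have h := hF (x, t) ⟨hx, mem_univ t⟩ ε hε
  rw [nhdsWithin_prod_eq, nhdsWithin_univ] at h
  have hlim : Tendsto (fun t' : T => (x, t')) (𝓝 t) (𝓝[Q] x ×ˢ 𝓝 t) :=
    (tendsto_nhdsWithin_iff.2 ⟨tendsto_const_nhds, .of_forall fun _ => hx⟩).prodMk tendsto_id
  exact hlim.eventually h

variable [CompactSpace T]

/-- A tube argument: joint continuity at `(x, t)` controls both `F (x', t')` and `F (x, t')` against
`F (x, t)`, and compactness of `T` removes the dependence on `t`. -/
theorem PHContinuousOn.eventually_forall_lt [PseudoEMetricSpace E] {F : M × T → Set E} {Q : Set M}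
    (hF : PHContinuousOn F (Q ×ˢ univ)) {x : M} (hx : x ∈ Q) {ε : ℝ≥0∞} (hε : 0 < ε) :
    ∀ᶠ x' in 𝓝[Q] x, ∀ t, Metric.hausdorffEDist (F (x', t)) (F (x, t)) < ε := by
  have hloc : ∀ t ∈ (univ : Set T),
      {z : M × T | Metric.hausdorffEDist (F z) (F (x, z.2)) < ε} ∈ 𝓝[Q] x ×ˢ 𝓝 t := by
    intro t _
    have h := hF (x, t) ⟨hx, mem_univ t⟩ (ε / 2) (ENNReal.half_pos hε.ne')
    rw [nhdsWithin_prod_eq, nhdsWithin_univ] at h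
    have h' : ∀ᶠ z : M × T in 𝓝[Q] x ×ˢ 𝓝 t,
        Metric.hausdorffEDist (F (x, z.2)) (F (x, t)) < ε / 2 :=
      tendsto_snd.eventually (hF.eventually_right_lt hx t (ENNReal.half_pos hε.ne'))
    filter_upwards [h, h'] with z h1 h2
    calc Metric.hausdorffEDist (F z) (F (x, z.2))
        ≤ Metric.hausdorffEDist (F z) (F (x, t)) + Metric.hausdorffEDist (F (x, t)) (F (x, z.2)) :=
          Metric.hausdorffEDist_triangle
      _ < ε / 2 + ε / 2 := by
          rw [Metric.hausdorffEDist_comm (s := F (x, t))]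
          exact ENNReal.add_lt_add h1 h2
      _ = ε := ENNReal.add_halves ε
  have h := isCompact_univ.mem_prod_nhdsSet_of_forall hloc
  rw [nhdsSet_univ, mem_prod_top] at h
  exact h

theorem norm_le_add_one_of_hausdorffEDist_lt_one [SeminormedAddCommGroup E] {A B : Set E} {R : ℝ}
    (hAB : Metric.hausdorffEDist A B < 1) (hB : ∀ p ∈ B, ‖p‖ ≤ R) : ∀ p ∈ A, ‖p‖ ≤ R + 1 := by
  intro p hp
  obtain ⟨q, hq, hpq⟩ := Metric.exists_edist_lt_of_hausdorffEDist_lt hp hAB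
  rw [edist_dist, ENNReal.ofReal_lt_one, dist_eq_norm] at hpq
  have h1 := hB q hq
  have h2 := norm_le_norm_add_norm_sub' p q
  linarith

theorem PHContinuousOn.exists_forall_norm_le [SeminormedAddCommGroup E] {F : M × T → Set E}
    {Q : Set M} (hF : PHContinuousOn F (Q ×ˢ univ)) {x : M} (hx : x ∈ Q)
    (hbdd : ∀ t, ∃ R : ℝ, ∀ p ∈ F (x, t), ‖p‖ ≤ R) :
    ∃ R : ℝ, ∀ t, ∀ p ∈ F (x, t), ‖p‖ ≤ R := by
  have h : ∃ R : ℝ, ∀ t ∈ (univ : Set T), ∀ p ∈ F (x, t), ‖p‖ ≤ R := by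
    refine isCompact_univ.induction_on (p := fun s => ∃ R : ℝ, ∀ t ∈ s, ∀ p ∈ F (x, t), ‖p‖ ≤ R)
      ⟨0, by simp⟩ (fun s t hst ⟨R, hR⟩ => ⟨R, fun a ha => hR a (hst ha)⟩) ?_ ?_
    · rintro s t ⟨R, hR⟩ ⟨R', hR'⟩
      refine ⟨max R R', fun a ha p hp => ?_⟩
      rcases ha with ha | ha
      · exact (hR a ha p hp).trans (le_max_left _ _)
      · exact (hR' a ha p hp).trans (le_max_right _ _)
    · intro t _
      obtain ⟨R, hR⟩ := hbdd t
      rw [nhdsWithin_univ]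
      exact ⟨_, hF.eventually_right_lt hx t one_pos, R + 1,
        fun t' ht' => norm_le_add_one_of_hausdorffEDist_lt_one ht' hR⟩
  obtain ⟨R, hR⟩ := h
  exact ⟨R, fun t => hR t (mem_univ t)⟩

end Uniform

theorem toReal_le_supFun {X T : Type*} {f : X → T → EReal} {x : X} {t : T}
    (ht : x ∈ dom fun x => f x t) (hx : x ∈ dom (supFun f)) : (f x t).toReal ≤ (supFun f x).toReal :=
  EReal.toReal_le_toReal (le_supFun f x t) ht.2 hx.1

theorem supFun_toReal_sub_le {X T : Type*} {f : X → T → EReal} [TopologicalSpace T]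
    [CompactSpace T] [Nonempty T] (hcont : ∀ x, Continuous fun t => f x t) {x y : X}
    (hy : y ∈ ⋂ t, dom fun x => f x t) {δ : ℝ}
    (h : ∀ t, (f x t).toReal - (f y t).toReal ≤ δ) :
    (supFun f x).toReal - (supFun f y).toReal ≤ δ := by
  obtain ⟨t, ht⟩ := exists_eq_supFun hcont x
  have h1 := toReal_le_supFun (mem_iInter.1 hy t) (iInter_dom_subset_dom_supFun hcont hy)
  have h2 := h t
  rw [ht] at h2
  linarith

/-! ### The hypodifferential of the maximum function -/

section MaxFunction

variable {X : Type*} [NormedAddCommGroup X] [NormedSpace ℝ X]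
  {T : Type*} {f : X → T → EReal} {d : T → X → Set (HypoSpace X)} {Q : Set X} {x : X}

/-- The set whose convex hull is `preHypodiff f d x`. -/
def hypodiffGenerators (f : X → T → EReal) (d : T → X → Set (HypoSpace X)) (x : X) :
    Set (HypoSpace X) :=
  {q | ∃ t : T, ∃ p ∈ d t x,
    q = WithLp.toLp 1 ((f x t).toReal - (supFun f x).toReal, (0 : StrongDual ℝ X)) + p}

theorem generator_affine_le (hd : ∀ t, IsConsistentHypodifferentialOn (fun x => f x t) Q (d t))
    (hx : x ∈ Q) {y : X} (hy : y ∈ dom (supFun f)) :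
    ∀ q ∈ hypodiffGenerators f d x,
      q.fst + q.snd (y - x) ≤ (supFun f y).toReal - (supFun f x).toReal := by
  rintro _ ⟨t, p, hp, rfl⟩
  have h1 := ((hd t).add_le hx hp y).trans (le_supFun f y t)
  rw [← coe_toReal_of_mem_dom hy, EReal.coe_le_coe_iff] at h1
  change (f x t).toReal - (supFun f x).toReal + p.fst + (0 + p.snd (y - x)) ≤ _
  linarith

theorem mem_iInter_dom (hd : ∀ t, IsConsistentHypodifferentialOn (fun x => f x t) Q (d t))
    (hx : x ∈ Q) : x ∈ ⋂ t, dom fun x => f x t :=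
  mem_iInter.2 fun t => ((hd t).1 x hx).mem_dom

theorem subset_generators_of_active {t : T} (ht : f x t = supFun f x) :
    d t x ⊆ hypodiffGenerators f d x := by
  intro p hp
  refine ⟨t, p, hp, ?_⟩
  rw [ht, sub_self]
  exact (zero_add p).symm

/-- Generators with the same index are compared: their shifts differ by at most `2 * δ`, their
unshifted parts by less than `δ`. -/
theorem exists_generator_dist_lt {x y : X} {δ : ℝ}
    (hf : ∀ t, |(f x t).toReal - (f y t).toReal| ≤ δ)
    (hs : |(supFun f x).toReal - (supFun f y).toReal| ≤ δ)
    (hxy : ∀ t, Metric.hausdorffEDist (d t x) (d t y) < ENNReal.ofReal δ) :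
    ∀ p ∈ hypodiffGenerators f d x, ∃ q ∈ hypodiffGenerators f d y, dist p q < 3 * δ := by
  rintro _ ⟨t, p, hp, rfl⟩
  obtain ⟨q, hq, hpq⟩ := Metric.exists_edist_lt_of_hausdorffEDist_lt hp (hxy t)
  refine ⟨_, ⟨t, q, hq, rfl⟩, (dist_add_add_le _ _ _ _).trans_lt ?_⟩
  have hpq' : dist p q < δ := by
    rw [edist_dist] at hpq
    exact (ENNReal.ofReal_lt_ofReal_iff_of_nonneg dist_nonneg).1 hpq
  rw [WithLp.dist_toLp_fst, Real.dist_eq]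
  have h1 := abs_le.1 (hf t)
  have h2 := abs_le.1 hs
  have h3 : |(f x t).toReal - (supFun f x).toReal - ((f y t).toReal - (supFun f y).toReal)|
      ≤ 2 * δ := abs_le.2 ⟨by linarith, by linarith⟩
  linarith

variable [TopologicalSpace T] [CompactSpace T]

/-- Near a point of `Q` the functions `f(·, t)` are close to their values there, uniformly
in `t`. -/
theorem eventually_forall_abs_toReal_sub_le [CompleteSpace X]
    (hd : ∀ t, IsConsistentHypodifferentialOn (fun x => f x t) Q (d t))
    (hdcont : PHContinuousOn (fun z : X × T => d z.2 z.1) (Q ×ˢ univ)) (hx : x ∈ Q)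
    {δ : ℝ} (hδ : 0 < δ) :
    ∀ᶠ y in 𝓝[Q] x, ∀ t, |(f y t).toReal - (f x t).toReal| ≤ δ := by
  obtain ⟨R, hR⟩ := hdcont.exists_forall_norm_le hx
    fun t => ((hd t).1 x hx).compact.exists_norm_le
  have hlim : Tendsto (fun y => (R + 1) * ‖y - x‖) (𝓝[Q] x) (𝓝 ((R + 1) * ‖x - x‖)) :=
    Tendsto.mono_left (Continuous.tendsto (by fun_prop) x) nhdsWithin_le_nhds
  rw [sub_self, norm_zero, mul_zero] at hlim
  filter_upwards [hdcont.eventually_forall_lt hx one_pos, hlim.eventually (gt_mem_nhds hδ),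
    self_mem_nhdsWithin] with y h1 h2 hy t
  -- `R + 1` bounds the hypodifferentials at `y` as well as at `x`, giving a Lipschitz estimate in
  -- both directions.
  have hRy := norm_le_add_one_of_hausdorffEDist_lt_one (h1 t) (hR t)
  have h3 := (hd t).toReal_sub_le hy hx hRy
  have h4 := (hd t).toReal_sub_le hx hy
    (fun p hp => (hR t p hp).trans (le_add_of_nonneg_right zero_le_one))
  rw [norm_sub_rev x y] at h4
  exact abs_le.2 ⟨by linarith, by linarith⟩

variable [Nonempty T]

/-- The shift `f(x,t) - f(x)` is nonpositive and, by compactness of `T`, at least `min_t f(x,t) -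
f(x)`. -/
theorem exists_generator_norm_le (hcont : ∀ x, Continuous fun t => f x t)
    (hx : x ∈ ⋂ t, dom fun x => f x t) {R : ℝ} (hR : ∀ t, ∀ p ∈ d t x, ‖p‖ ≤ R) :
    ∃ R' : ℝ, ∀ q ∈ hypodiffGenerators f d x, ‖q‖ ≤ R' := by
  obtain ⟨t₀, -, ht₀⟩ := isCompact_univ.exists_isMinOn univ_nonempty (hcont x).continuousOn
  refine ⟨(supFun f x).toReal - (f x t₀).toReal + R, ?_⟩
  rintro _ ⟨t, p, hp, rfl⟩
  refine (norm_add_le _ _).trans (add_le_add ?_ (hR t p hp))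
  have hsup := toReal_le_supFun (mem_iInter.1 hx t) (iInter_dom_subset_dom_supFun hcont hx)
  have hinf : (f x t₀).toReal ≤ (f x t).toReal :=
    EReal.toReal_le_toReal (ht₀ (mem_univ t)) (mem_iInter.1 hx t₀).2 (mem_iInter.1 hx t).1
  rw [WithLp.norm_toLp_fst, Real.norm_eq_abs, abs_le]
  constructor <;> linarith

/-- The first-order expansion of the maximum function along a ray, as an upper estimate. -/
theorem eventually_supFun_ray_lt [CompleteSpace X] (hcont : ∀ x, Continuous fun t => f x t)
    (hconv : ∀ t, IsClosedConvex fun x => f x t)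
    (hd : ∀ t, IsConsistentHypodifferentialOn (fun x => f x t) Q (d t)) (hx : x ∈ Q)
    {H : Set (HypoSpace X)} (hH : IsWeakStarCompact H)
    (hH0 : IsGreatest ((fun p : HypoSpace X => p.fst) '' H) 0)
    (hgen : hypodiffGenerators f d x ⊆ H) (u : X) {ε : ℝ} (hε : 0 < ε) :
    ∀ᶠ α in 𝓝[>] (0 : ℝ), supFun f (x + α • u) <
      (((supFun f x).toReal + maxAffine H (α • u) + α * ε : ℝ) : EReal) := by
  have hdom := iInter_dom_subset_dom_supFun hcont (mem_iInter_dom hd hx)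
  set c := (supFun f x).toReal with hc
  have hcx : supFun f x = c := (coe_toReal_of_mem_dom hdom).symm
  obtain ⟨M, hM, hM'⟩ := exists_slope_maxAffine hH hH0 u
  suffices h : ∀ᶠ α in 𝓝[>] (0 : ℝ),
      supFun f (x + α • u) < ((c + α * (M + ε) : ℝ) : EReal) by
    filter_upwards [h, self_mem_nhdsWithin] with α h hα
    refine h.trans_le (EReal.coe_le_coe_iff.2 ?_)
    have := hM α hα
    linarith
  by_contra hcon
  obtain ⟨t, ht⟩ := exists_forall_ray_le hcont hconv hcx hcon
  have hdt := (hd t).1 x hx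
  have hne : (d t x).Nonempty := hdt.max_zero.nonempty.of_image
  obtain ⟨R, hR⟩ := hdt.compact.exists_norm_le
  have happrox : ∀ᶠ α in 𝓝[>] (0 : ℝ),
      c + α * (M + ε) ≤ (f x t).toReal + maxAffine (d t x) (α • u) + α * (ε / 2) := by
    have h := (tendsto_scaled_abs_iff _).1 (hdt.approx u) (ε / 2) (half_pos hε)
    filter_upwards [h, self_mem_nhdsWithin] with α h hα
    have hα' : (0 : ℝ) < α := hα
    rw [← coe_toReal_of_mem_dom hdt.mem_dom] at h
    exact EReal.coe_le_coe_iff.1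
      ((ht α hα').trans (le_of_abs_sub_sub_le (by positivity) h))
  -- Since `a ≤ 0` and `‖x*‖ ≤ R`, the max term is at most `α R ‖u‖`; letting `α → 0` leaves `c ≤
  -- f(x,t)`.
  have hactive : f x t = supFun f x := by
    have hle : c ≤ (f x t).toReal := by
      have hlim : Tendsto (fun α : ℝ => (f x t).toReal + α * (R * ‖u‖ + ε / 2 - (M + ε)))
          (𝓝[>] 0) (𝓝 ((f x t).toReal + 0 * (R * ‖u‖ + ε / 2 - (M + ε)))) :=
        Tendsto.mono_left (Continuous.tendsto (by fun_prop) 0) nhdsWithin_le_nhds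
      rw [zero_mul, add_zero] at hlim
      refine ge_of_tendsto hlim ?_
      filter_upwards [happrox, self_mem_nhdsWithin] with α h hα
      have hα' : (0 : ℝ) < α := hα
      have hmax : maxAffine (d t x) (α • u) ≤ α * (R * ‖u‖) := by
        refine maxAffine_le hne fun p hp => ?_
        have h0 : p.fst ≤ 0 := hdt.max_zero.2 ⟨p, hp, rfl⟩
        have h1 : p.snd u ≤ R * ‖u‖ := (snd_apply_le p u).trans
          (mul_le_mul_of_nonneg_right (hR p hp) (norm_nonneg u))
        rw [map_smul, smul_eq_mul]
        have h2 := mul_le_mul_of_nonneg_left h1 hα'.le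
        linarith
      linarith
    refine le_antisymm (le_supFun f x t) ?_
    rw [hcx, ← coe_toReal_of_mem_dom hdt.mem_dom]
    exact EReal.coe_le_coe_iff.2 hle
  -- Splitting `ε` into halves makes the expansion of `f_t` and the slope bound for `H` give `α (M +
  -- ε) < α (M + ε)`.
  obtain ⟨α, h1, h2⟩ := (happrox.and (hM' (ε / 2) (half_pos hε))).exists
  have h3 := maxAffine_mono hne hH ((subset_generators_of_active hactive).trans hgen) (α • u)
  rw [hactive, ← hc] at h1
  linarith

theorem exists_generators_norm_le [CompleteSpace X] (hcont : ∀ x, Continuous fun t => f x t)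
    (hd : ∀ t, IsConsistentHypodifferentialOn (fun x => f x t) Q (d t))
    (hdcont : PHContinuousOn (fun z : X × T => d z.2 z.1) (Q ×ˢ univ)) (hx : x ∈ Q) :
    ∃ R : ℝ, ∀ q ∈ hypodiffGenerators f d x, ‖q‖ ≤ R := by
  obtain ⟨R, hR⟩ := hdcont.exists_forall_norm_le hx
    fun t => ((hd t).1 x hx).compact.exists_norm_le
  exact exists_generator_norm_le hcont (mem_iInter_dom hd hx) hR

/-- The weak* closed convex hull of the shifted hypodifferentials is a consistent
hypodifferential mapping of the maximum function. -/
theorem isConsistentHypodifferentialOn_supFun [CompleteSpace X]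
    (hcont : ∀ x, Continuous fun t => f x t) (hconv : ∀ t, IsClosedConvex fun x => f x t)
    (hd : ∀ t, IsConsistentHypodifferentialOn (fun x => f x t) Q (d t))
    (hdcont : PHContinuousOn (fun z : X × T => d z.2 z.1) (Q ×ˢ univ)) :
    IsConsistentHypodifferentialOn (supFun f) Q
      (fun x => weakStarClosure (preHypodiff f d x)) := by
  have hcons : ∀ x ∈ Q, ∀ y : X, ∀ p ∈ weakStarClosure (preHypodiff f d x),
      (((supFun f x).toReal + (p.fst + p.snd (y - x)) : ℝ) : EReal) ≤ supFun f y := by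
    intro x hx y p hp
    by_cases hy : supFun f y = ⊤
    · rw [hy]; exact le_top
    have hy' : y ∈ dom (supFun f) := ⟨hy, (IsClosedConvex.supFun hconv).ne_bot y⟩
    have h := affine_le_of_mem_weakStarClosure_convexHull (generator_affine_le hd hx hy') p hp
    rw [← coe_toReal_of_mem_dom hy']
    exact EReal.coe_le_coe_iff.2 (by linarith)
  have hdom : ∀ x ∈ Q, x ∈ dom (supFun f) := fun x hx =>
    iInter_dom_subset_dom_supFun hcont (mem_iInter_dom hd hx)
  refine ⟨fun x hx => ?_, fun x hx y p hp => ?_⟩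
  · obtain ⟨R, hR⟩ := exists_generators_norm_le hcont hd hdcont hx
    have hcomp : IsWeakStarCompact (weakStarClosure (preHypodiff f d x)) :=
      isWeakStarCompact_weakStarClosure (convexHull_norm_le hR)
    have hgen : hypodiffGenerators f d x ⊆ weakStarClosure (preHypodiff f d x) :=
      (subset_convexHull ℝ _).trans (subset_weakStarClosure _)
    have hmax : IsGreatest ((fun p : HypoSpace X => p.fst) ''
        weakStarClosure (preHypodiff f d x)) 0 := by
      constructor
      · obtain ⟨t, ht⟩ := exists_eq_supFun hcont x
        obtain ⟨p, hp, hp0⟩ := ((hd t).1 x hx).max_zero.1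
        exact ⟨p, hgen (subset_generators_of_active ht hp), hp0⟩
      · rintro _ ⟨p, hp, rfl⟩
        have h := affine_le_of_mem_weakStarClosure_convexHull
          (generator_affine_le hd hx (hdom x hx)) p hp
        simpa using h
    refine ⟨hdom x hx, hcomp, hmax, fun u => (tendsto_scaled_abs_iff _).2 fun ε hε => ?_⟩
    filter_upwards [eventually_supFun_ray_lt hcont hconv hd hx hcomp hmax hgen u hε,
      self_mem_nhdsWithin] with α hα hα0
    rw [← coe_toReal_of_mem_dom (hdom x hx)]
    refine abs_sub_sub_le ?_ hα.le
    have hfin : x + α • u ∈ dom (supFun f) :=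
      ⟨(hα.trans (EReal.coe_lt_top _)).ne, (IsClosedConvex.supFun hconv).ne_bot _⟩
    -- The lower estimate is consistency evaluated at `x + α • u`, maximized over the
    -- hypodifferential.
    rw [← coe_toReal_of_mem_dom hfin, EReal.coe_le_coe_iff, add_comm, ← le_sub_iff_add_le]
    refine maxAffine_le hmax.nonempty.of_image fun p hp => ?_
    have h := hcons x hx (x + α • u) p hp
    rw [← coe_toReal_of_mem_dom hfin, EReal.coe_le_coe_iff, add_sub_cancel_left] at h
    linarith
  · have h := hcons x hx y p hp
    rw [EReal.coe_add, coe_toReal_of_mem_dom (hdom x hx), add_comm] at h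
    exact EReal.le_sub_iff_add_le (.inl (hdom x hx).2) (.inl (hdom x hx).1) |>.2 h

/-- The hypodifferential mapping of the maximum function is continuous. Neither reflexivity nor
weak* closedness of norm closures is needed: the sum of a weak* compact set and a ball is weak*
closed, so the Pompeiu-Hausdorff estimate passes to weak* closures. -/
theorem phContinuousOn_supFun [CompleteSpace X] (hcont : ∀ x, Continuous fun t => f x t)
    (hd : ∀ t, IsConsistentHypodifferentialOn (fun x => f x t) Q (d t))
    (hdcont : PHContinuousOn (fun z : X × T => d z.2 z.1) (Q ×ˢ univ)) :
    PHContinuousOn (fun x => weakStarClosure (preHypodiff f d x)) Q := by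
  intro x hx ε hε
  obtain ⟨r, hr, hrε⟩ := ENNReal.lt_iff_exists_nnreal_btwn.1 hε
  have hr0 : (0 : ℝ) < r := by exact_mod_cast hr
  -- Generators move by less than `3 * δ`, and passing to weak* closed hulls doubles this.
  set δ : ℝ := r / 6 with hδ
  have hδ0 : 0 < δ := by positivity
  filter_upwards [eventually_forall_abs_toReal_sub_le hd hdcont hx hδ0,
    hdcont.eventually_forall_lt hx (ENNReal.ofReal_pos.2 hδ0), self_mem_nhdsWithin] with y hf hH hy
  have hxd := mem_iInter_dom hd hx
  have hyd := mem_iInter_dom hd hy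
  have hs : |(supFun f y).toReal - (supFun f x).toReal| ≤ δ := by
    have h1 := supFun_toReal_sub_le hcont hxd fun t => (abs_le.1 (hf t)).2
    have h2 := supFun_toReal_sub_le hcont (x := x) hyd (δ := δ) fun t => by
      linarith [(abs_le.1 (hf t)).1]
    exact abs_le.2 ⟨by linarith, h1⟩
  obtain ⟨Rx, hRx⟩ := exists_generators_norm_le hcont hd hdcont hx
  obtain ⟨Ry, hRy⟩ := exists_generators_norm_le hcont hd hdcont hy
  have hle : ∀ p q : HypoSpace X, dist p q ≤ 2 * (3 * δ) → edist p q ≤ r := fun p q h => by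
    rw [edist_dist, ← ENNReal.ofReal_coe_nnreal]
    exact ENNReal.ofReal_le_ofReal (by linarith)
  refine lt_of_le_of_lt (Metric.hausdorffEDist_le_of_mem_edist (fun p hp => ?_) fun p hp => ?_) hrε
  · obtain ⟨q, hq, hpq⟩ := exists_dist_le_of_mem_weakStarClosure_convexHull hRx
      (exists_generator_dist_lt hf hs hH) p hp
    exact ⟨q, hq, hle p q hpq⟩
  · obtain ⟨q, hq, hpq⟩ := exists_dist_le_of_mem_weakStarClosure_convexHull hRy
      (exists_generator_dist_lt (fun t => by rw [abs_sub_comm]; exact hf t)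
        (by rw [abs_sub_comm]; exact hs)
        fun t => by rw [Metric.hausdorffEDist_comm]; exact hH t) p hp
    exact ⟨q, hq, hle p q hpq⟩

end MaxFunction

end Hypodiff

theorem mainTheorem5 {X : Type*} [NormedAddCommGroup X] [NormedSpace ℝ X] [CompleteSpace X]
    {T : Type*} [TopologicalSpace T] [CompactSpace T] [Nonempty T]
    (f : X → T → EReal)
    (hcont : ∀ x, Continuous (fun t => f x t))
    (hconv : ∀ t, Hypodiff.IsClosedConvex (fun x => f x t))
    (Q : Set X) (hQne : Q.Nonempty)
    (hQ : Q ⊆ interior (⋂ t, Hypodiff.dom (fun x => f x t)))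
    (d : T → X → Set (Hypodiff.HypoSpace X))
    (hd : ∀ t, Hypodiff.IsConsistentHypodifferentialOn (fun x => f x t) Q (d t))
    (hdcont : Hypodiff.PHContinuousOn (fun z : X × T => d z.2 z.1) (Q ×ˢ Set.univ)) :
    Hypodiff.IsClosedConvex (Hypodiff.supFun f) ∧
    (∀ x ∈ Q, Hypodiff.HypodifferentiableAt (Hypodiff.supFun f) x) ∧
    Hypodiff.IsConsistentHypodifferentialOn (Hypodiff.supFun f) Q
      (fun x => Hypodiff.weakStarClosure (Hypodiff.preHypodiff f d x)) ∧
    ((Hypodiff.IsReflexive X ∨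
        ∀ x ∈ Q, Hypodiff.IsWeakStarClosed (closure (Hypodiff.preHypodiff f d x))) →
      Hypodiff.ContinuouslyHypodifferentiableOn (Hypodiff.supFun f) Q ∧
      Hypodiff.PHContinuousOn
        (fun x => Hypodiff.weakStarClosure (Hypodiff.preHypodiff f d x)) Q) := by
  have hmap := Hypodiff.isConsistentHypodifferentialOn_supFun hcont hconv hd hdcont
  have hcontin := Hypodiff.phContinuousOn_supFun hcont hd hdcont
  exact ⟨.supFun hconv, fun x hx => ⟨_, hmap.1 x hx⟩, hmap, fun _ =>
    ⟨⟨hQ.trans (interior_mono (Hypodiff.iInter_dom_subset_dom_supFun hcont)),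
      _, hmap.1, hcontin⟩, hcontin⟩⟩
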